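/- Let $\mathbf D=\{z\in\mathbb C:|z|<1\}$ and let $L^2(\mathbf T^2)$ be the complex Hilbert space of square-integrable functions on the 2-torus $\mathbf T^2=\partial\mathbf D\times\partial\mathbf D$, with inner product \[\langle f,g\rangle=\frac1{4\pi^2}\int_{-\pi}^{\pi}\int_{-\pi}^{\pi}f(e^{it},e^{is})\,\overline{g(e^{it},e^{is})}\,dt\,ds .\] Let $H^2(\mathbf T^2)$ be the set of $f\in L^2(\mathbf T^2)$ such that $f(e^{it},e^{is})=\sum_{k,l\ge0}c_{kl}e^{i(kt+ls)}$ in the $L^2$ sense, where $c_{kl}=\langle f,e_{kl}\rangle$ and $e_{kl}(t,s)=e^{ikt}e^{ils}$. For a sequence $\mathbf a=(a_1,a_2,\dots)$ in $\mathbf D$, let \[B^{\mathbf a}_n(z)=\frac{\sqrt{1-|a_n|^2}}{1-\overline{a_n}z}\prod_{l=1}^{n-1}\frac{z-a_l}{1-\overline{a_l}z},\qquad n=1,2,\dots,\] be its Takenaka--Malmquist (TM) system. For sequences $\mathbf a,\mathbf b$ in $\mathbf D$, put $(B^{\mathbf a}_k\otimes B^{\mathbf b}_l)(e^{it},e^{is})=B^{\mathbf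 a}_k(e^{it})B^{\mathbf b}_l(e^{is})$ and, for $f\in H^2(\mathbf T^2)$, \[S_0(f)=0,\qquad S_n(f)=\sum_{1\le k,l\le n}\langle f,B^{\mathbf a}_k\otimes B^{\mathbf b}_l\rangle\,B^{\mathbf a}_k\otimes B^{\mathbf b}_l,\qquad D_n(f)=S_n(f)-S_{n-1}(f)\qquad(n\ge1).\] Note that $D_n(f)$ depends only on $a_1,b_1,\dots,a_n,b_n$. The pair $(a_n,b_n)$ is said to be selected according to the Maximal Selection Principle if, with $a_1,b_1,\dots,a_{n-1},b_{n-1}$ fixed, it maximises $\|D_n(f)\|^2$ among all choices of the $n$-th pair in $\mathbf D\times\mathbf D$. \textbf{Theorem.} Let $f\in H^2(\mathbf T^2)$ and $k_0\ge1$, let $a_1,b_1,\dots,a_{k_0-1},b_{k_0-1}\in\mathbf D$ be arbitrary, and let the pairs $(a_n,b_n)$, $n\ge k_0$, be selected successively according to the Maximal Selection Principle. Then \[\lim_{n\to\infty}\|f-S_n(f)\|^2=0,\] that is, $f=\lim_{n\to\infty}S_n(f)$ in the $L^2$-convergence sense. -/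

import Mathlib

open MeasureTheory Filter Topology
open scoped ComplexConjugate ENNReal

namespace ProductTM

/-- The two-dimensional torus `𝐓²`. A point `x` of `(ℝ/ℤ)²` stands for
`(e^{it}, e^{is})` with `t = 2π x₀`, `s = 2π x₁`. -/
abbrev Torus2 : Type := UnitAddTorus (Fin 2)

/-- The normalised measure `dt ds / (4π²)` on the torus: the product of the Haar probability
measures of the two circles. -/
noncomputable abbrev torusMeasure : Measure Torus2 :=
  Measure.pi fun _ => AddCircle.haarAddCircle

/-- The complex Hilbert space `L²(𝐓²)`, with inner product `(4π²)⁻¹ ∫∫ f conj(g) dt ds`. -/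
abbrev L2T2 : Type := Lp ℂ 2 torusMeasure

/-- The coordinate `e^{2πi xⱼ}` of a point of the torus, as a complex number. -/
noncomputable def coord (j : Fin 2) (x : Torus2) : ℂ := ((x j).toCircle : ℂ)

/-- The exponential `e_{kl}(t, s) = e^{ikt} e^{ils}` as an element of `L²(𝐓²)`. -/
noncomputable def expLp (k l : ℤ) : L2T2 :=
  ContinuousMap.toLp 2 torusMeasure ℂ (UnitAddTorus.mFourier ![k, l])

/-- The Hardy space `H²(𝐓²)`: the functions of `L²(𝐓²)` which are, in the `L²` sense, the sum of
their Fourier series over the non-negative frequencies,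
`f(e^{it}, e^{is}) = ∑_{k,l ≥ 0} c_{kl} e^{i(kt+ls)}`, `c_{kl} = ⟨f, e_{kl}⟩`. Mathlib's inner
product is linear in its second argument, so `⟨f, g⟩` is `inner ℂ g f`. -/
def HardyT2 : Set L2T2 :=
  {f | HasSum (fun p : ℕ × ℕ => (inner ℂ (expLp p.1 p.2) f : ℂ) • expLp p.1 p.2) f}

/-- The `n`-th function (`n ≥ 1`) of the Takenaka-Malmquist system of the sequence
`a 1, a 2, …` in the unit disc (`a 0` is not used):
`B_n(z) = √(1-|a_n|²) / (1 - conj(a_n) z) * ∏_{l=1}^{n-1} (z - a_l) / (1 - conj(a_l) z)`. -/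
noncomputable def tm (a : ℕ → Complex.UnitDisc) (n : ℕ) (z : ℂ) : ℂ :=
  (Real.sqrt (1 - ‖(a n : ℂ)‖ ^ 2) : ℂ) / (1 - conj (a n : ℂ) * z) *
    ∏ l ∈ Finset.Ico 1 n, (z - (a l : ℂ)) / (1 - conj (a l : ℂ) * z)

theorem continuous_coord (j : Fin 2) : Continuous (coord j) := by
  unfold coord
  exact continuous_subtype_val.comp
    ((AddCircle.continuous_toCircle).comp (continuous_apply j))

theorem norm_coord (j : Fin 2) (x : Torus2) : ‖coord j x‖ = 1 := by
  exact Circle.norm_coe _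

theorem one_sub_conj_mul_coord_ne_zero (c : Complex.UnitDisc) (j : Fin 2) (x : Torus2) :
    1 - conj (c : ℂ) * coord j x ≠ 0 := by
  intro h
  have h1 : ‖conj (c : ℂ) * coord j x‖ = 1 := by
    rw [← sub_eq_zero.mp h, norm_one]
  rw [norm_mul, norm_coord, mul_one, RCLike.norm_conj] at h1
  exact absurd h1 c.norm_lt_one.ne

theorem continuous_tm_coord (a : ℕ → Complex.UnitDisc) (n : ℕ) (j : Fin 2) :
    Continuous fun x : Torus2 => tm a n (coord j x) := by
  unfold tm
  have hc := continuous_coord j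
  refine Continuous.mul (Continuous.div (by fun_prop) (by fun_prop)
    fun x => one_sub_conj_mul_coord_ne_zero _ j x) ?_
  exact continuous_finsetProd _ fun l _ => Continuous.div (by fun_prop) (by fun_prop)
    fun x => one_sub_conj_mul_coord_ne_zero _ j x

/-- The continuous function `(B^a_k ⊗ B^b_l)(e^{it}, e^{is}) = B^a_k(e^{it}) B^b_l(e^{is})`. -/
noncomputable def tensorTMFun (a b : ℕ → Complex.UnitDisc) (k l : ℕ) : C(Torus2, ℂ) where
  toFun x := tm a k (coord 0 x) * tm b l (coord 1 x)
  continuous_toFun := (continuous_tm_coord a k 0).mul (continuous_tm_coord b l 1)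

/-- `B^a_k ⊗ B^b_l` as an element of `L²(𝐓²)`. -/
noncomputable def tensorTM (a b : ℕ → Complex.UnitDisc) (k l : ℕ) : L2T2 :=
  ContinuousMap.toLp 2 torusMeasure ℂ (tensorTMFun a b k l)

/-- `S_n(f) = ∑_{1 ≤ k,l ≤ n} ⟨f, B^a_k ⊗ B^b_l⟩ B^a_k ⊗ B^b_l`. -/
noncomputable def partialSum (a b : ℕ → Complex.UnitDisc) (f : L2T2) (n : ℕ) : L2T2 :=
  ∑ k ∈ Finset.Icc 1 n, ∑ l ∈ Finset.Icc 1 n,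
    (inner ℂ (tensorTM a b k l) f : ℂ) • tensorTM a b k l

/-- The `n`-th partial sum difference (`n ≥ 1`), `D_n(f) = S_n(f) - S_{n-1}(f)`. It depends on
`a 1, …, a n` and `b 1, …, b n` only. -/
noncomputable def partialDiff (a b : ℕ → Complex.UnitDisc) (f : L2T2) (n : ℕ) : L2T2 :=
  partialSum a b f n - partialSum a b f (n - 1)

/-- The pair `(a n, b n)` is selected according to the Maximal Selection Principle: with
`a 1, …, a (n-1)` and `b 1, …, b (n-1)` kept fixed, it maximises `‖D_n(f)‖²` among all possible
choices of the `n`-th pair of parameters in the unit disc. -/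
def IsMaximalSelection (a b : ℕ → Complex.UnitDisc) (f : L2T2) (n : ℕ) : Prop :=
  ∀ z w : Complex.UnitDisc,
    ‖partialDiff (Function.update a n z) (Function.update b n w) f n‖ ^ 2 ≤
      ‖partialDiff a b f n‖ ^ 2

end ProductTM

namespace ProductTM

/-! ### The Takenaka-Malmquist functions on the unit circle -/

/-! The tensor system is orthonormal, so `S_n f` converges to some `s`, with `f - s` orthogonal to
`s`, and `‖D_n f‖ → 0`. It remains to show `f - s ⟂ f`. Fix `(z, w)` and replace the `n`-th pair by
it. By Christoffel-Darboux (`sum_conj_tm_mul_tm`) the Szegő kernel `K` at `(z, w)` lies in the span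
of the first `n × n` functions of the modified system, while `S_{n-1} f` is unchanged. Hence `⟨f -
S_{n-1} f, K⟩ = ⟨D'_n f, K⟩`, where `D'_n` is the modified difference, and maximality bounds this by
`‖K‖ ‖D_n f‖ → 0` (`norm_inner_szegoMap_sub_partialSum_le`). So `f - s` is orthogonal to every Szegő
kernel, hence to all of `H²` (`inner_eq_zero_of_mem_hardyT2`), in particular to `f`. -/

theorem one_sub_conj_mul_ne_zero (c : Complex.UnitDisc) {z : ℂ} (hz : ‖z‖ ≤ 1) :
    1 - conj (c : ℂ) * z ≠ 0 := by
  intro h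
  have h1 : ‖conj (c : ℂ) * z‖ = 1 := by rw [← sub_eq_zero.mp h, norm_one]
  rw [norm_mul, RCLike.norm_conj] at h1
  nlinarith [c.norm_lt_one, norm_nonneg (c : ℂ)]

theorem sub_ne_zero_of_norm_eq_one (c : Complex.UnitDisc) {z : ℂ} (hz : ‖z‖ = 1) :
    z - (c : ℂ) ≠ 0 := by
  intro h
  rw [sub_eq_zero.mp h] at hz
  exact c.norm_lt_one.ne hz

theorem mul_conj_eq_one {z : ℂ} (hz : ‖z‖ = 1) : z * conj z = 1 := by
  rw [Complex.mul_conj, Complex.normSq_eq_norm_sq, hz]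
  norm_num

theorem one_sub_mul_conj_ne_zero (c : Complex.UnitDisc) {z : ℂ} (hz : ‖z‖ ≤ 1) :
    1 - (c : ℂ) * conj z ≠ 0 := by
  have h := one_sub_conj_mul_ne_zero c hz
  intro h'
  apply h
  simpa using congrArg conj h'

theorem sqrt_mul_sqrt_one_sub_norm_sq (c : Complex.UnitDisc) :
    (Real.sqrt (1 - ‖(c : ℂ)‖ ^ 2) : ℂ) * (Real.sqrt (1 - ‖(c : ℂ)‖ ^ 2) : ℂ) =
      1 - conj (c : ℂ) * c := by
  rw [← Complex.ofReal_mul, Real.mul_self_sqrt, mul_comm (conj (c : ℂ)), Complex.mul_conj,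
    Complex.normSq_eq_norm_sq]
  · push_cast; ring
  · nlinarith [c.norm_lt_one, norm_nonneg (c : ℂ)]

/-- A factor of a finite Blaschke product has modulus one on the unit circle. -/
theorem blaschkeFactor_mul_conj (c : Complex.UnitDisc) {z : ℂ} (hz : ‖z‖ = 1) :
    (z - (c : ℂ)) / (1 - conj (c : ℂ) * z) * conj ((z - (c : ℂ)) / (1 - conj (c : ℂ) * z)) = 1 := by
  have h1 := one_sub_conj_mul_ne_zero c hz.le
  have h2 := one_sub_mul_conj_ne_zero c hz.le
  have h3 := mul_conj_eq_one hz
  simp only [map_div₀, map_sub, map_mul, map_one, Complex.conj_conj]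
  rw [div_mul_div_comm, div_eq_one_iff_eq (mul_ne_zero h1 h2)]
  linear_combination (1 - conj (c : ℂ) * c) * h3

/-- The analytic factor of `tm a l * conj (tm a k)`, which on the unit circle equals
`z / (z - a k)` times this function. -/
noncomputable def tmGram (a : ℕ → Complex.UnitDisc) (k l : ℕ) (z : ℂ) : ℂ :=
  (Real.sqrt (1 - ‖(a k : ℂ)‖ ^ 2) : ℂ) *
    ((Real.sqrt (1 - ‖(a l : ℂ)‖ ^ 2) : ℂ) / (1 - conj (a l : ℂ) * z)) *
      ∏ m ∈ Finset.Ico k l, (z - (a m : ℂ)) / (1 - conj (a m : ℂ) * z)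

/-- The common Blaschke factors are unimodular and cancel, and `1 / (1 - a * conj z) = z / (z - a)`
on the circle. The result has the shape of a Cauchy integrand, so its mean over the circle is
`tmGram a k l (a k)`. -/
theorem tm_mul_conj_tm (a : ℕ → Complex.UnitDisc) {k l : ℕ} (hk : 1 ≤ k) (hkl : k ≤ l) {z : ℂ}
    (hz : ‖z‖ = 1) :
    tm a l z * conj (tm a k z) = ((z - 0) / (z - a k)) • tmGram a k l z := by
  have h2 := one_sub_mul_conj_ne_zero (a k) hz.le
  have h3 := mul_conj_eq_one hz
  have h4 := sub_ne_zero_of_norm_eq_one (a k) hz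
  have hP : (∏ m ∈ Finset.Ico 1 k, (z - (a m : ℂ)) / (1 - conj (a m : ℂ) * z)) *
      conj (∏ m ∈ Finset.Ico 1 k, (z - (a m : ℂ)) / (1 - conj (a m : ℂ) * z)) = 1 := by
    rw [map_prod, ← Finset.prod_mul_distrib]
    exact Finset.prod_eq_one fun m _ => blaschkeFactor_mul_conj (a m) hz
  have hq : 1 / (1 - (a k : ℂ) * conj z) = z / (z - a k) := by
    rw [div_eq_div_iff h2 h4]
    linear_combination (a k : ℂ) * h3
  rw [tm, tm, tmGram, ← Finset.prod_Ico_consecutive _ hk hkl, smul_eq_mul, sub_zero, ← hq]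
  rw [map_mul, map_div₀, map_sub, map_mul, Complex.conj_conj, map_one, Complex.conj_ofReal]
  set P := ∏ m ∈ Finset.Ico 1 k, (z - (a m : ℂ)) / (1 - conj (a m : ℂ) * z)
  set Q := ∏ m ∈ Finset.Ico k l, (z - (a m : ℂ)) / (1 - conj (a m : ℂ) * z)
  linear_combination ((Real.sqrt (1 - ‖(a l : ℂ)‖ ^ 2) : ℂ) / (1 - conj (a l : ℂ) * z) * Q *
    ((Real.sqrt (1 - ‖(a k : ℂ)‖ ^ 2) : ℂ) / (1 - (a k : ℂ) * conj z))) * hP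

theorem diffContOnCl_tmGram (a : ℕ → Complex.UnitDisc) (k l : ℕ) :
    DiffContOnCl ℂ (tmGram a k l) (Metric.ball 0 |(1 : ℝ)|) := by
  refine DifferentiableOn.diffContOnCl fun z hz => DifferentiableAt.differentiableWithinAt ?_
  rw [abs_one, closure_ball (0 : ℂ) one_ne_zero, mem_closedBall_zero_iff] at hz
  have hd (m : ℕ) := one_sub_conj_mul_ne_zero (a m) hz
  unfold tmGram
  refine DifferentiableAt.mul (DifferentiableAt.mul (by fun_prop)
    (DifferentiableAt.div (by fun_prop) (by fun_prop) (hd l))) ?_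
  exact DifferentiableAt.fun_finsetProd fun m _ =>
    DifferentiableAt.div (by fun_prop) (by fun_prop) (hd m)

theorem tmGram_self (a : ℕ → Complex.UnitDisc) (k : ℕ) : tmGram a k k (a k) = 1 := by
  rw [tmGram, Finset.Ico_self, Finset.prod_empty, mul_one, mul_div_assoc',
    sqrt_mul_sqrt_one_sub_norm_sq,
    div_self (one_sub_conj_mul_ne_zero (a k) (a k).norm_lt_one.le)]

theorem tmGram_of_lt (a : ℕ → Complex.UnitDisc) {k l : ℕ} (h : k < l) :
    tmGram a k l (a k) = 0 := by
  rw [tmGram, Finset.prod_eq_zero (Finset.mem_Ico.mpr ⟨le_rfl, h⟩) (by simp), mul_zero]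

theorem integral_toCircle_eq_circleAverage (F : ℂ → ℂ) :
    ∫ x : UnitAddCircle, F (x.toCircle : ℂ) ∂AddCircle.haarAddCircle = Real.circleAverage F 0 1 := by
  rw [AddCircle.integral_haarAddCircle, Real.circleAverage,
    ← AddCircle.intervalIntegral_preimage 1 0]
  have h := intervalIntegral.integral_comp_mul_left (a := 0) (b := 1)
    (fun θ => F (circleMap 0 1 θ)) Real.two_pi_pos.ne'
  simp only [mul_zero, mul_one] at h
  rw [← h]
  simp [AddCircle.toCircle_apply_mk, circleMap]

theorem integral_tm_mul_conj_tm (a : ℕ → Complex.UnitDisc) {k l : ℕ} (hk : 1 ≤ k) (hl : 1 ≤ l) :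
    ∫ x : UnitAddCircle, tm a l (x.toCircle : ℂ) * conj (tm a k (x.toCircle : ℂ))
      ∂AddCircle.haarAddCircle = if k = l then 1 else 0 := by
  -- Conjugation swaps the indices; the Cauchy form requires the longer Blaschke product to be the
  -- unconjugated one.
  wlog hkl : k ≤ l generalizing k l
  · have h := congrArg conj (this hl hk (le_of_not_ge hkl))
    rw [← integral_conj] at h
    simp only [map_mul, Complex.conj_conj] at h
    simp_rw [mul_comm (conj _)] at h
    rw [h]
    simp [eq_comm, apply_ite conj]
  rw [integral_toCircle_eq_circleAverage fun z => tm a l z * conj (tm a k z),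
    Real.circleAverage_congr_sphere (f₂ := fun z => ((z - 0) / (z - a k)) • tmGram a k l z)
      fun z hz => tm_mul_conj_tm a hk hkl (by simpa using hz),
    (diffContOnCl_tmGram a k l).circleAverage_smul_div (by simpa using (a k).norm_lt_one)]
  split_ifs with h
  · subst h; exact tmGram_self a k
  · exact tmGram_of_lt a (lt_of_le_of_ne hkl h)

theorem inner_tensorTM (a b : ℕ → Complex.UnitDisc) {k l k' l' : ℕ} (hk : 1 ≤ k) (hl : 1 ≤ l)
    (hk' : 1 ≤ k') (hl' : 1 ≤ l') :
    (inner ℂ (tensorTM a b k l) (tensorTM a b k' l') : ℂ) =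
      (if k = k' then 1 else 0) * if l = l' then 1 else 0 := by
  rw [tensorTM, tensorTM, ContinuousMap.inner_toLp]
  have h := integral_fintype_prod_eq_prod (𝕜 := ℂ)
    (μ := fun _ : Fin 2 => (AddCircle.haarAddCircle : Measure UnitAddCircle))
    (f := ![fun x : UnitAddCircle => tm a k' (x.toCircle : ℂ) * conj (tm a k (x.toCircle : ℂ)),
      fun x : UnitAddCircle => tm b l' (x.toCircle : ℂ) * conj (tm b l (x.toCircle : ℂ))])
  simp only [Fin.prod_univ_two, Matrix.cons_val_zero, Matrix.cons_val_one] at h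
  rw [integral_tm_mul_conj_tm a hk hk', integral_tm_mul_conj_tm b hl hl'] at h
  rw [← h]
  refine integral_congr_ae (Eventually.of_forall fun x => ?_)
  simp only [tensorTMFun, ContinuousMap.coe_mk, coord, map_mul]
  ring

/-- The tensor products of the two Takenaka-Malmquist systems, indexed from zero. -/
theorem orthonormal_tensorTM (a b : ℕ → Complex.UnitDisc) :
    Orthonormal ℂ fun p : ℕ × ℕ => tensorTM a b (p.1 + 1) (p.2 + 1) := by
  rw [orthonormal_iff_ite]
  rintro ⟨k, l⟩ ⟨k', l'⟩
  rw [inner_tensorTM a b (by omega) (by omega) (by omega) (by omega)]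
  simp only [Nat.add_right_cancel_iff, Prod.mk.injEq]
  split_ifs <;> simp_all

/-! ### Christoffel-Darboux and the Szegő kernel -/

/-- The Christoffel-Darboux formula for the Takenaka-Malmquist system. -/
theorem sum_conj_tm_mul_tm (a : ℕ → Complex.UnitDisc) {z ζ : ℂ} (hz : ‖z‖ < 1) (hζ : ‖ζ‖ ≤ 1)
    (n : ℕ) :
    (∑ k ∈ Finset.Icc 1 n, conj (tm a k z) * tm a k ζ) * (1 - conj z * ζ) =
      1 - conj (∏ l ∈ Finset.Icc 1 n, (z - (a l : ℂ)) / (1 - conj (a l : ℂ) * z)) *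
        ∏ l ∈ Finset.Icc 1 n, (ζ - (a l : ℂ)) / (1 - conj (a l : ℂ) * ζ) := by
  induction n with
  | zero => simp
  | succ n ih =>
    have h1 := one_sub_mul_conj_ne_zero (a (n + 1)) hz.le
    have h2 := one_sub_conj_mul_ne_zero (a (n + 1)) hζ
    rw [Finset.sum_Icc_succ_top (by omega), Finset.prod_Icc_succ_top (by omega),
      Finset.prod_Icc_succ_top (by omega), add_mul, ih]
    have hI : Finset.Ico 1 (n + 1) = Finset.Icc 1 n := by ext; simp
    rw [tm, tm, hI]
    simp only [map_mul, map_div₀, map_sub, map_one, Complex.conj_conj, Complex.conj_ofReal]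
    set P := conj (∏ l ∈ Finset.Icc 1 n, (z - (a l : ℂ)) / (1 - conj (a l : ℂ) * z))
    set Q := ∏ l ∈ Finset.Icc 1 n, (ζ - (a l : ℂ)) / (1 - conj (a l : ℂ) * ζ)
    have hs := sqrt_mul_sqrt_one_sub_norm_sq (a (n + 1))
    set s := (Real.sqrt (1 - ‖(a (n + 1) : ℂ)‖ ^ 2) : ℂ)
    field_simp
    -- What remains is `(1 - a z̄)(1 - ā ζ) - (z̄ - ā)(ζ - a) = (1 - |a|²)(1 - z̄ ζ)`.
    linear_combination P * Q * (1 - conj z * ζ) * hs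

/-- If `a n = z`, the Szegő kernel at `z` is a combination of the first `n` functions of the
Takenaka-Malmquist system. -/
theorem sum_conj_tm_mul_tm_of_eq (a : ℕ → Complex.UnitDisc) {n : ℕ} (hn : 1 ≤ n) {ζ : ℂ}
    (hζ : ‖ζ‖ ≤ 1) :
    ∑ k ∈ Finset.Icc 1 n, conj (tm a k (a n)) * tm a k ζ = (1 - conj (a n : ℂ) * ζ)⁻¹ := by
  have h := sum_conj_tm_mul_tm a (a n).norm_lt_one hζ n
  -- The Blaschke product vanishes at `a n` through its factor `l = n`.
  rw [Finset.prod_eq_zero (Finset.mem_Icc.mpr ⟨hn, le_rfl⟩) (by simp), map_zero, zero_mul,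
    sub_zero] at h
  exact eq_inv_of_mul_eq_one_left h

/-! ### Completeness of the Szegő kernels in the Hardy space -/

/-- The coordinate `e^{2πi xⱼ}` as a continuous function on the torus. -/
noncomputable def coordMap (j : Fin 2) : C(Torus2, ℂ) := ⟨coord j, continuous_coord j⟩

/-- The Szegő kernel `(1 - conj z · e^{2πi xⱼ})⁻¹` as a continuous function on the torus. -/
noncomputable def szegoMap (j : Fin 2) (z : Complex.UnitDisc) : C(Torus2, ℂ) where
  toFun x := (1 - conj (z : ℂ) * coord j x)⁻¹
  continuous_toFun :=
    Continuous.inv₀ (continuous_const.sub (continuous_const.mul (continuous_coord j)))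
      fun x => one_sub_conj_mul_coord_ne_zero z j x

theorem norm_coordMap_le (j : Fin 2) : ‖coordMap j‖ ≤ 1 :=
  (ContinuousMap.norm_le _ zero_le_one).mpr fun x => (norm_coord j x).le

/-- A geometric series in the Banach algebra `C(Torus2, ℂ)`; uniform convergence allows a continuous
functional to be applied termwise. -/
theorem hasSum_szegoMap (j : Fin 2) (z : Complex.UnitDisc) :
    HasSum (fun n : ℕ => conj (z : ℂ) ^ n • coordMap j ^ n) (szegoMap j z) := by
  have hlt : ‖conj (z : ℂ) • coordMap j‖ < 1 := by
    rw [norm_smul, RCLike.norm_conj]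
    calc ‖(z : ℂ)‖ * ‖coordMap j‖ ≤ ‖(z : ℂ)‖ * 1 := by gcongr; exact norm_coordMap_le j
      _ < 1 := by rw [mul_one]; exact z.norm_lt_one
  have hmul : (1 - conj (z : ℂ) • coordMap j) * szegoMap j z = 1 := by
    ext x
    exact mul_inv_cancel₀ (one_sub_conj_mul_coord_ne_zero z j x)
  have hsum : ∑' n : ℕ, (conj (z : ℂ) • coordMap j) ^ n = szegoMap j z :=
    left_inv_eq_right_inv (geom_series_mul_neg _ hlt) hmul
  have h := (summable_geometric_of_norm_lt_one hlt).hasSum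
  rw [hsum] at h
  simpa only [smul_pow] using h

theorem coeff_eq_zero_of_hasSum_zero {c : ℕ → ℂ}
    (h : ∀ z : ℂ, ‖z‖ < 1 → HasSum (fun n => z ^ n * c n) 0) (n : ℕ) : c n = 0 := by
  have hp : HasFPowerSeriesAt (0 : ℂ → ℂ) (FormalMultilinearSeries.ofScalars ℂ c) 0 := by
    rw [hasFPowerSeriesAt_iff]
    filter_upwards [Metric.ball_mem_nhds (0 : ℂ) one_pos] with z hz
    simpa using h z (by simpa using hz)
  exact congrFun ((FormalMultilinearSeries.ofScalars_series_eq_zero (E := ℂ)).mp hp.eq_zero) n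

/-- Applied to the geometric series, `φ` gives a power series in `conj z` that vanishes on the disc,
so its coefficients vanish. The free factor `h` lets the two variables be treated one at a time. -/
theorem map_coordMap_pow_mul_eq_zero (φ : C(Torus2, ℂ) →L[ℂ] ℂ) (j : Fin 2) (h : C(Torus2, ℂ))
    (H : ∀ z, φ (szegoMap j z * h) = 0) (n : ℕ) : φ (coordMap j ^ n * h) = 0 := by
  refine coeff_eq_zero_of_hasSum_zero (c := fun n => φ (coordMap j ^ n * h)) (fun z hz => ?_) n
  have hz' : ‖conj z‖ < 1 := by rwa [RCLike.norm_conj]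
  have hs := φ.hasSum ((hasSum_szegoMap j (Complex.UnitDisc.mk (conj z) hz')).mul_right h)
  rw [H] at hs
  simpa [smul_mul_assoc] using hs

theorem coordMap_pow_mul_coordMap_pow (k l : ℕ) :
    coordMap 0 ^ k * (coordMap 1 ^ l * 1) = UnitAddTorus.mFourier ![(k : ℤ), (l : ℤ)] := by
  ext x
  simp [coordMap, coord, UnitAddTorus.mFourier, fourier_apply, AddCircle.toCircle_nsmul]

/-- An element of `L²` orthogonal to all the Szegő kernels of the bidisc is orthogonal to the
exponentials of non-negative frequencies. -/
theorem inner_expLp_eq_zero (g : L2T2)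
    (H : ∀ z w, (inner ℂ g (ContinuousMap.toLp 2 torusMeasure ℂ (szegoMap 0 z * szegoMap 1 w)) : ℂ)
      = 0) (k l : ℕ) : (inner ℂ g (expLp k l) : ℂ) = 0 := by
  let φ : C(Torus2, ℂ) →L[ℂ] ℂ := (innerSL ℂ g).comp (ContinuousMap.toLp 2 torusMeasure ℂ)
  have h1 (w : Complex.UnitDisc) (k : ℕ) : φ (coordMap 0 ^ k * szegoMap 1 w) = 0 :=
    map_coordMap_pow_mul_eq_zero φ 0 _ (fun z => H z w) k
  have h2 : φ (coordMap 1 ^ l * (coordMap 0 ^ k * 1)) = 0 :=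
    map_coordMap_pow_mul_eq_zero φ 1 _ (fun w => by simpa [mul_comm] using h1 w k) l
  rw [mul_left_comm, coordMap_pow_mul_coordMap_pow] at h2
  exact h2

theorem inner_eq_zero_of_mem_hardyT2 {f g : L2T2} (hf : f ∈ HardyT2)
    (H : ∀ z w, (inner ℂ g (ContinuousMap.toLp 2 torusMeasure ℂ (szegoMap 0 z * szegoMap 1 w)) : ℂ)
      = 0) : (inner ℂ g f : ℂ) = 0 := by
  have h := (innerSL ℂ g).hasSum hf
  have h0 : (fun p : ℕ × ℕ => innerSL ℂ g ((inner ℂ (expLp p.1 p.2) f : ℂ) • expLp p.1 p.2)) =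
      fun _ => 0 := by
    funext p
    rw [map_smul, innerSL_apply_apply, inner_expLp_eq_zero g H, smul_zero]
  rw [h0] at h
  exact h.unique hasSum_zero

/-! ### Convergence of the partial sums -/

theorem partialSum_eq_sum_range (a b : ℕ → Complex.UnitDisc) (f : L2T2) (n : ℕ) :
    partialSum a b f n = ∑ p ∈ Finset.range n ×ˢ Finset.range n,
      (inner ℂ (tensorTM a b (p.1 + 1) (p.2 + 1)) f : ℂ) • tensorTM a b (p.1 + 1) (p.2 + 1) := by
  have hI (F : ℕ → L2T2) : ∑ k ∈ Finset.Icc 1 n, F k = ∑ k ∈ Finset.range n, F (k + 1) := by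
    rw [Finset.range_eq_Ico, Finset.sum_Ico_add' F 0 n 1]
    rfl
  rw [partialSum, Finset.sum_product, hI]
  exact Finset.sum_congr rfl fun k _ => hI _

theorem inner_partialSum (a b : ℕ → Complex.UnitDisc) (f : L2T2) {k l n : ℕ}
    (hk : k ∈ Finset.Icc 1 n) (hl : l ∈ Finset.Icc 1 n) :
    (inner ℂ (tensorTM a b k l) (partialSum a b f n) : ℂ) = inner ℂ (tensorTM a b k l) f := by
  rw [Finset.mem_Icc] at hk hl
  have h := (orthonormal_tensorTM a b).inner_right_sum
    (fun p : ℕ × ℕ => (inner ℂ (tensorTM a b (p.1 + 1) (p.2 + 1)) f : ℂ))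
    (s := Finset.range n ×ˢ Finset.range n) (i := (k - 1, l - 1)) (by simp; omega)
  rw [partialSum_eq_sum_range]
  simpa only [Nat.sub_add_cancel hk.1, Nat.sub_add_cancel hl.1] using h

/-- In a Hilbert space the Fourier series of a vector along an orthonormal family converges. -/
theorem _root_.Orthonormal.summable_inner_smul {ι E : Type*} [NormedAddCommGroup E]
    [InnerProductSpace ℂ E] [CompleteSpace E] {v : ι → E} (hv : Orthonormal ℂ v) (f : E) :
    Summable fun i => (inner ℂ (v i) f : ℂ) • v i := by
  have h := hv.orthogonalFamily.summable_iff_norm_sq_summable (fun i => (inner ℂ (v i) f : ℂ))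
  simpa using h.mpr (hv.inner_products_summable f)

theorem exists_tendsto_partialSum (a b : ℕ → Complex.UnitDisc) (f : L2T2) :
    ∃ s, Tendsto (partialSum a b f) atTop (𝓝 s) := by
  obtain ⟨s, hs⟩ := (orthonormal_tensorTM a b).summable_inner_smul f
  refine ⟨s, ?_⟩
  have hsq : Tendsto (fun n => Finset.range n ×ˢ Finset.range n) atTop atTop := by
    -- The squares are cofinal: `p` lies in the one of side `p.1 + p.2 + 1`.
    refine tendsto_atTop_finset_of_monotone (fun m n h => ?_) fun p => ⟨p.1 + p.2 + 1, ?_⟩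
    · exact Finset.product_subset_product (Finset.range_mono h) (Finset.range_mono h)
    · simp
  exact (hs.comp hsq).congr fun n => (partialSum_eq_sum_range a b f n).symm

/-- Each coefficient of `partialSum a b f m` is eventually that of `f`, so `s` and `f` have the same
coefficients. -/
theorem inner_partialSum_sub_limit (a b : ℕ → Complex.UnitDisc) {f s : L2T2}
    (hs : Tendsto (partialSum a b f) atTop (𝓝 s)) (n : ℕ) :
    (inner ℂ (partialSum a b f n) (f - s) : ℂ) = 0 := by
  have hu {k l : ℕ} (hk : 1 ≤ k) (hl : 1 ≤ l) : (inner ℂ (tensorTM a b k l) (f - s) : ℂ) = 0 := by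
    rw [inner_sub_right, sub_eq_zero]
    refine tendsto_nhds_unique (tendsto_const_nhds.congr' ?_) (tendsto_const_nhds.inner hs)
    filter_upwards [eventually_ge_atTop (max k l)] with m hm
    exact (inner_partialSum a b f (Finset.mem_Icc.mpr ⟨hk, by omega⟩)
      (Finset.mem_Icc.mpr ⟨hl, by omega⟩)).symm
  rw [partialSum, sum_inner]
  refine Finset.sum_eq_zero fun k hk => ?_
  rw [sum_inner]
  refine Finset.sum_eq_zero fun l hl => ?_
  rw [inner_smul_left, hu (Finset.mem_Icc.mp hk).1 (Finset.mem_Icc.mp hl).1, mul_zero]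

/-! ### Replacing the `n`-th pair, and passage to the limit -/

theorem tm_congr {a a' : ℕ → Complex.UnitDisc} {n : ℕ} (h : ∀ m, m ≤ n → a m = a' m) (z : ℂ) :
    tm a n z = tm a' n z := by
  rw [tm, tm, h n le_rfl]
  congr 1
  refine Finset.prod_congr rfl fun l hl => ?_
  rw [h l (Finset.mem_Ico.mp hl).2.le]

theorem partialSum_congr {a a' b b' : ℕ → Complex.UnitDisc} {n : ℕ}
    (ha : ∀ m, m ≤ n → a m = a' m) (hb : ∀ m, m ≤ n → b m = b' m) (f : L2T2) :
    partialSum a b f n = partialSum a' b' f n := by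
  have h {k l : ℕ} (hk : k ≤ n) (hl : l ≤ n) : tensorTM a b k l = tensorTM a' b' k l := by
    rw [tensorTM, tensorTM]
    congr 1
    ext x
    exact congrArg₂ (· * ·) (tm_congr (fun m hm => ha m (hm.trans hk)) _)
      (tm_congr (fun m hm => hb m (hm.trans hl)) _)
  rw [partialSum, partialSum]
  refine Finset.sum_congr rfl fun k hk => Finset.sum_congr rfl fun l hl => ?_
  rw [h (Finset.mem_Icc.mp hk).2 (Finset.mem_Icc.mp hl).2]

theorem szegoMap_mul_szegoMap_eq_sum (a b : ℕ → Complex.UnitDisc) {n : ℕ} (hn : 1 ≤ n) :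
    ContinuousMap.toLp 2 torusMeasure ℂ (szegoMap 0 (a n) * szegoMap 1 (b n)) =
      ∑ k ∈ Finset.Icc 1 n, ∑ l ∈ Finset.Icc 1 n,
        (conj (tm a k (a n)) * conj (tm b l (b n))) • tensorTM a b k l := by
  simp only [tensorTM, ← map_smul, ← map_sum]
  congr 1
  ext x
  have h0 := sum_conj_tm_mul_tm_of_eq a hn (norm_coord 0 x).le
  have h1 := sum_conj_tm_mul_tm_of_eq b hn (norm_coord 1 x).le
  simp only [szegoMap, ContinuousMap.mul_apply, ContinuousMap.coe_mk, ← h0, ← h1,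
    ContinuousMap.sum_apply, ContinuousMap.smul_apply, tensorTMFun, smul_eq_mul,
    Finset.sum_mul_sum]
  exact Finset.sum_congr rfl fun k _ => Finset.sum_congr rfl fun l _ => by ring

/-- The Szegő kernel at `(a n, b n)` does not see the difference between `f` and its `n`-th
partial sum. -/
theorem inner_szegoMap_partialSum (a b : ℕ → Complex.UnitDisc) (f : L2T2) {n : ℕ} (hn : 1 ≤ n) :
    (inner ℂ (ContinuousMap.toLp 2 torusMeasure ℂ (szegoMap 0 (a n) * szegoMap 1 (b n)))
      (partialSum a b f n) : ℂ) =
    inner ℂ (ContinuousMap.toLp 2 torusMeasure ℂ (szegoMap 0 (a n) * szegoMap 1 (b n))) f := by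
  rw [szegoMap_mul_szegoMap_eq_sum a b hn]
  simp only [sum_inner, inner_smul_left]
  refine Finset.sum_congr rfl fun k hk => Finset.sum_congr rfl fun l hl => ?_
  rw [inner_partialSum a b f hk hl]

theorem norm_inner_szegoMap_sub_partialSum_le {a b : ℕ → Complex.UnitDisc} {f : L2T2} {n : ℕ}
    (hn : 1 ≤ n) (hmax : IsMaximalSelection a b f n) (z w : Complex.UnitDisc) :
    ‖(inner ℂ (ContinuousMap.toLp 2 torusMeasure ℂ (szegoMap 0 z * szegoMap 1 w))
      (f - partialSum a b f (n - 1)) : ℂ)‖ ≤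
    ‖ContinuousMap.toLp 2 torusMeasure ℂ (szegoMap 0 z * szegoMap 1 w)‖ *
      ‖partialDiff a b f n‖ := by
  have hup (c : ℕ → Complex.UnitDisc) (z : Complex.UnitDisc) (m : ℕ) (hm : m ≤ n - 1) :
      c m = Function.update c n z m := (Function.update_of_ne (by omega) _ _).symm
  have h := inner_szegoMap_partialSum (Function.update a n z) (Function.update b n w) f hn
  rw [Function.update_self, Function.update_self] at h
  -- In the updated system `f` may be replaced by its `n`-th partial sum, and the sum of order `n -
  -- 1` is unaffected; the pairing is then with the updated difference.
  rw [inner_sub_right, ← h, ← inner_sub_right,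
    partialSum_congr (hup a z) (hup b w) f]
  refine (norm_inner_le_norm _ _).trans ?_
  gcongr
  exact le_of_sq_le_sq (hmax z w) (norm_nonneg _)

theorem tendsto_partialSum {f : L2T2} (hf : f ∈ HardyT2) {k₀ : ℕ} {a b : ℕ → Complex.UnitDisc}
    (hmax : ∀ n : ℕ, k₀ ≤ n → IsMaximalSelection a b f n) :
    Tendsto (partialSum a b f) atTop (𝓝 f) := by
  obtain ⟨s, hs⟩ := exists_tendsto_partialSum a b f
  have hs' : Tendsto (fun n => partialSum a b f (n - 1)) atTop (𝓝 s) :=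
    hs.comp (tendsto_sub_atTop_nat 1)
  have hD : Tendsto (fun n => ‖partialDiff a b f n‖) atTop (𝓝 0) := by
    simpa [partialDiff] using (hs.sub hs').norm
  have hker (z w : Complex.UnitDisc) : (inner ℂ (f - s)
      (ContinuousMap.toLp 2 torusMeasure ℂ (szegoMap 0 z * szegoMap 1 w)) : ℂ) = 0 := by
    rw [inner_eq_zero_symm]
    set K := ContinuousMap.toLp 2 torusMeasure ℂ (szegoMap 0 z * szegoMap 1 w) with hK
    have h1 : Tendsto (fun n => (inner ℂ K (f - partialSum a b f (n - 1)) : ℂ)) atTop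
        (𝓝 (inner ℂ K (f - s))) := tendsto_const_nhds.inner (tendsto_const_nhds.sub hs')
    refine tendsto_nhds_unique h1 (squeeze_zero_norm' ?_ (by simpa using hD.const_mul ‖K‖))
    filter_upwards [eventually_ge_atTop (max k₀ 1)] with n hn
    exact norm_inner_szegoMap_sub_partialSum_le (by omega) (hmax n (by omega)) z w
  have h2 : (inner ℂ s (f - s) : ℂ) = 0 :=
    tendsto_nhds_unique (hs.inner tendsto_const_nhds)
      (tendsto_const_nhds.congr fun n => (inner_partialSum_sub_limit a b hs n).symm)
  -- Only `f` has to be in the Hardy space: orthogonality to `s` comes from `h2`.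
  have h3 : (inner ℂ (f - s) (f - s) : ℂ) = 0 := by
    rw [inner_sub_right, inner_eq_zero_of_mem_hardyT2 hf hker, inner_eq_zero_symm.mp h2, sub_zero]
  rwa [← sub_eq_zero.mp (inner_self_eq_zero.mp h3)] at hs

end ProductTM

theorem mainTheorem1 (f : ProductTM.L2T2) (hf : f ∈ ProductTM.HardyT2)
    (k₀ : ℕ) (hk₀ : 1 ≤ k₀) (a b : ℕ → Complex.UnitDisc)
    (hmax : ∀ n : ℕ, k₀ ≤ n → ProductTM.IsMaximalSelection a b f n) :
    Tendsto (fun n : ℕ => ‖f - ProductTM.partialSum a b f n‖ ^ 2) atTop (𝓝 0) ∧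
      Tendsto (fun n : ℕ => ProductTM.partialSum a b f n) atTop (𝓝 f) := by
  have h := ProductTM.tendsto_partialSum hf hmax
  refine ⟨?_, h⟩
  simpa using ((tendsto_const_nhds (x := f)).sub h).norm.pow 2
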